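/- Let $(\Omega,\mathcal F,P)$ be a probability space such that $L_2(\Omega,\mathcal F,P)$ is separable. Let $\Lambda$ be the set of all sub-$\sigma$-fields of $\mathcal F$ that contain every $A\in\mathcal F$ with $P(A)=0$, ordered by inclusion. $\Lambda$ is a complete lattice, in which $x\wedge y=x\cap y$ and $x\vee y=\sigma(x,y)$ is the $\sigma$-field generated by $x\cup y$; infima are intersections and suprema are generated $\sigma$-fields. Its greatest element is $1_\Lambda=\mathcal F$ and its smallest element $0_\Lambda$ consists of the null sets in $\mathcal F$ and their complements. A *noise-type Boolean algebra* is a set $B\subset\Lambda$ with $0_\Lambda,1_\Lambda\in B$ such that: $x\wedge y\in B$ and $x\vee y\in B$ for all $x,y\in B$; $x\wedge(y\vee z)=(x\wedge y)\vee(x\wedge z)$ for all $x,y,z\in B$; every $x\in B$ has a (necessarily unique) complement $x'\in B$, that is, $x\wedge x'=0_\Lambda$ and $x\vee x'=1_\Lambda$; and for every $x\in B$ the $\sigma$-fields $x$ and $x'$ are independent under $P$. **Theorem.** Let $B\subset\Lambda$ be a noise-type Boolean algebra, let $$\operatorname{Cl}(B)=\Big\{\liminf_n x_n : x_1,x_2,\dots\in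 B\Big\},\qquad \liminf_n x_n=\sup_n\inf_k x_{n+k},$$ and let $$C=\{x\in\operatorname{Cl}(B) : \exists\, y\in\operatorname{Cl}(B)\ \; x\wedge y=0_\Lambda,\ x\vee y=1_\Lambda\}.$$ Then (a) $C$ is a noise-type Boolean algebra such that $B\subset C\subset\operatorname{Cl}(B)$; (b) $C$ contains every noise-type Boolean algebra $C_1$ satisfying $B\subset C_1\subset\operatorname{Cl}(B)$. ($C$ is called the noise-type completion of $B$.) -/

import Mathlib

open MeasureTheory

namespace NoiseType

/-- The set `Λ` of all sub-σ-fields of `mΩ` that contain every null set. It is ordered by inclusion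
and closed under the (nonempty) infima and suprema of `MeasurableSpace Ω`, which are intersections
and generated σ-fields; so `⊓`, `⊔`, `⨅`, `⨆` below are the lattice operations of `Λ`. -/
def sigmaFields {Ω : Type*} {mΩ : MeasurableSpace Ω} (P : Measure Ω) : Set (MeasurableSpace Ω) :=
  {x | x ≤ mΩ ∧ ∀ s : Set Ω, MeasurableSet[mΩ] s → P s = 0 → MeasurableSet[x] s}

/-- The smallest element `0_Λ`: the σ-field of null sets and their complements. -/
def trivialField {Ω : Type*} {mΩ : MeasurableSpace Ω} (P : Measure Ω) : MeasurableSpace Ω where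
  MeasurableSet' s := MeasurableSet[mΩ] s ∧ (P s = 0 ∨ P sᶜ = 0)
  measurableSet_empty := ⟨MeasurableSet.empty, Or.inl measure_empty⟩
  measurableSet_compl s hs := ⟨hs.1.compl, by rw [compl_compl]; exact hs.2.symm⟩
  measurableSet_iUnion f hf := by
    refine ⟨MeasurableSet.iUnion fun i => (hf i).1, ?_⟩
    by_cases h : ∀ i, P (f i) = 0
    · exact Or.inl (measure_iUnion_null h)
    · push Not at h
      obtain ⟨i, hi⟩ := h
      exact Or.inr (measure_mono_null (Set.compl_subset_compl.2 (Set.subset_iUnion f i))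
        ((hf i).2.resolve_left hi))

/-- `y` is a complement of `x` in `Λ`: `x ∧ y = 0_Λ` and `x ∨ y = 1_Λ`, where `1_Λ = mΩ`. -/
def IsComplement {Ω : Type*} {mΩ : MeasurableSpace Ω} (P : Measure Ω)
    (x y : MeasurableSpace Ω) : Prop :=
  x ⊓ y = trivialField P ∧ x ⊔ y = mΩ

/-- Noise-type Boolean algebras: distributive sublattices of `Λ` containing `0_Λ` and `1_Λ` in which
every element is complemented and independent of its (necessarily unique) complement. -/
structure IsNoiseTypeBooleanAlgebra {Ω : Type*} {mΩ : MeasurableSpace Ω} (P : Measure Ω)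
    (B : Set (MeasurableSpace Ω)) : Prop where
  subset_sigmaFields : B ⊆ sigmaFields P
  inf_mem : ∀ x ∈ B, ∀ y ∈ B, x ⊓ y ∈ B
  sup_mem : ∀ x ∈ B, ∀ y ∈ B, x ⊔ y ∈ B
  distrib : ∀ x ∈ B, ∀ y ∈ B, ∀ z ∈ B, x ⊓ (y ⊔ z) = (x ⊓ y) ⊔ (x ⊓ z)
  zero_mem : trivialField P ∈ B
  one_mem : mΩ ∈ B
  exists_complement : ∀ x ∈ B, ∃ y ∈ B, IsComplement P x y
  indep_complement : ∀ x ∈ B, ∀ y ∈ B, IsComplement P x y → ProbabilityTheory.Indep x y P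

/-- `Cl(B)`: the set of lower limits `sup_n inf_k x_{n+k}` of all sequences of elements of `B`. -/
def closure {Ω : Type*} (B : Set (MeasurableSpace Ω)) : Set (MeasurableSpace Ω) :=
  {x | ∃ u : ℕ → MeasurableSpace Ω, (∀ n, u n ∈ B) ∧ x = ⨆ n, ⨅ k, u (n + k)}

/-- The set of all elements of `Cl(B)` that have a complement in `Cl(B)`. -/
def completion {Ω : Type*} {mΩ : MeasurableSpace Ω} (P : Measure Ω)
    (B : Set (MeasurableSpace Ω)) : Set (MeasurableSpace Ω) :=
  {x | x ∈ closure B ∧ ∃ y ∈ closure B, IsComplement P x y}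

end NoiseType

namespace NoiseType

open Filter Topology ProbabilityTheory

/-! Each σ-field `x` is studied through its conditional expectation operator `E_x` on `L₁`. Within
`B` one has `E_y E_x = E_{y ⊓ x}`: distributivity gives `x = (y ⊓ x) ⊔ (y' ⊓ x)`, and the second
part is independent of `y`. This identity survives strong limits (`strongClosure_isCommuting`).
Separability then identifies Cl(B) with the strong sequential closure (`closure_eq_strongClosure`):
lower limits are strong limits by martingale convergence and a diagonal argument, and a strong limit
is the lower limit of any sufficiently fast subsequence.

Joins are harder. The key is `closure_sup_inf_complement`: if `x`, `y` in Cl(B) are complementary,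
then every `u` in Cl(B) is `(u ⊓ x) ⊔ (u ⊓ y)`. For `u` in `B`, approximate `x`, `y` by `a n`, `b n`
in `B`. These are conditionally independent given `u ⊔ (a n ⊓ b n)`, which tends to `u` because `a n
⊓ b n` tends to `0_Λ`; so `x`, `y` are conditionally independent given `u` (`isProd_condOp_ind`).
This passes to limits in `u`, so `E_u (1_A 1_D) = E_{u ⊓ x} 1_A · E_{u ⊓ y} 1_D` for `A` in `x` and
`D` in `y`, which is measurable for the smaller join.

Hence joining `u` with a complemented `z` involves only `u ⊓ z'`, and below `z'` joining with `z` is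
strongly continuous by independence (`StrongTendsto.sup_of_indep`). This gives `closure_sup_mem`,
distributivity and complements of meets. Maximality is immediate, since complements taken in `C₁`
lie in Cl(B). -/

/-- The conditional expectation given `x`, as an operator on `L₁`. -/
noncomputable def condOp {Ω : Type*} (x : MeasurableSpace Ω) {mΩ : MeasurableSpace Ω}
    (P : Measure Ω) [IsProbabilityMeasure P] : Lp ℝ 1 P →L[ℝ] Lp ℝ 1 P :=
  open Classical in if h : x ≤ mΩ then condExpL1CLM ℝ h P else 0

/-- The subspace of `L₁` of functions measurable with respect to `x`, up to a null set. -/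
noncomputable def measL1 {Ω : Type*} (x : MeasurableSpace Ω) {mΩ : MeasurableSpace Ω}
    (P : Measure Ω) : Submodule ℝ (Lp ℝ 1 P) := lpMeas ℝ ℝ x 1 P

/-- The indicator of a measurable set, as an element of `L₁`. -/
noncomputable def ind {Ω : Type*} {mΩ : MeasurableSpace Ω} (P : Measure Ω)
    [IsProbabilityMeasure P] {A : Set Ω} (hA : MeasurableSet A) : Lp ℝ 1 P :=
  indicatorConstLp 1 hA (measure_ne_top P A) 1

/-- `h` is the pointwise product of `f` and `g`. -/
def IsProd {Ω : Type*} {mΩ : MeasurableSpace Ω} {P : Measure Ω} (f g h : Lp ℝ 1 P) : Prop :=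
  ⇑h =ᵐ[P] ⇑f * ⇑g

/-- `f` is bounded by `1`. -/
def BddOne {Ω : Type*} {mΩ : MeasurableSpace Ω} {P : Measure Ω} (f : Lp ℝ 1 P) : Prop :=
  ∀ᵐ ω ∂P, |f ω| ≤ 1

/-! ### Measurable subspaces of `L₁` and products with bounded functions. -/

section Basic

variable {Ω : Type*} {x y : MeasurableSpace Ω} {mΩ : MeasurableSpace Ω} {P : Measure Ω}

theorem mem_measL1 {f : Lp ℝ 1 P} : f ∈ measL1 x P ↔ AEStronglyMeasurable[x] f P :=
  mem_lpMeas_iff_aestronglyMeasurable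

theorem measL1_mono (h : x ≤ y) : measL1 x P ≤ measL1 y P := fun f hf => by
  rw [mem_measL1] at *
  exact hf.mono h

theorem isClosed_measL1 (hx : x ≤ mΩ) : IsClosed (measL1 x P : Set (Lp ℝ 1 P)) := by
  have : (measL1 x P : Set (Lp ℝ 1 P)) = {f : Lp ℝ 1 P | AEStronglyMeasurable[x] f P} := by
    ext f; exact mem_measL1
  rw [this]
  exact isClosed_aestronglyMeasurable hx

/-- For a `σ`-field containing the null sets, every version is measurable. -/
theorem measurable_of_mem_measL1 {f : Lp ℝ 1 P} (hx : x ∈ sigmaFields P)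
    (hf : f ∈ measL1 x P) {g : Ω → ℝ} (hg : Measurable g) (hfg : g =ᵐ[P] f) :
    Measurable[x] g := by
  rw [mem_measL1] at hf
  obtain ⟨k, hk, hfk⟩ := hf
  have hgk : g =ᵐ[P] k := hfg.trans hfk
  intro s hs
  have h1 : MeasurableSet[x] (k ⁻¹' s) := hk.measurable hs
  have hd : ∀ t : Set Ω, MeasurableSet[mΩ] t → t ⊆ {ω | g ω ≠ k ω} → MeasurableSet[x] t :=
    fun t ht hts => hx.2 t ht (measure_mono_null hts hgk)
  have h2 : MeasurableSet[x] (g ⁻¹' s \ k ⁻¹' s) :=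
    hd _ ((hg hs).diff (hx.1 _ h1)) fun ω hω h => hω.2 (by simpa [← h] using hω.1)
  have h3 : MeasurableSet[x] (k ⁻¹' s \ g ⁻¹' s) :=
    hd _ ((hx.1 _ h1).diff (hg hs)) fun ω hω h => hω.2 (by simpa [h] using hω.1)
  have h4 : g ⁻¹' s = (k ⁻¹' s ∪ (g ⁻¹' s \ k ⁻¹' s)) \ (k ⁻¹' s \ g ⁻¹' s) := by
    ext ω; simp only [Set.mem_sdiff, Set.mem_union]; tauto
  rw [h4]
  exact (h1.union h2).diff h3

theorem exists_version (f : Lp ℝ 1 P) : ∃ g : Ω → ℝ, Measurable g ∧ g =ᵐ[P] f :=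
  ⟨_, (Lp.aestronglyMeasurable f).stronglyMeasurable_mk.measurable,
    (Lp.aestronglyMeasurable f).ae_eq_mk.symm⟩

/-- Null sets belong to both σ-fields, so one and the same version of `f` is measurable for both. -/
theorem mem_measL1_inf {f : Lp ℝ 1 P} (hx : x ∈ sigmaFields P) (hy : y ∈ sigmaFields P)
    (hfx : f ∈ measL1 x P) (hfy : f ∈ measL1 y P) : f ∈ measL1 (x ⊓ y) P := by
  obtain ⟨g, hg, hgf⟩ := exists_version f
  rw [mem_measL1]
  refine ⟨g, Measurable.stronglyMeasurable ?_, hgf.symm⟩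
  intro s hs
  exact MeasurableSpace.measurableSet_inf.2 ⟨measurable_of_mem_measL1 hx hfx hg hgf hs,
    measurable_of_mem_measL1 hy hfy hg hgf hs⟩

theorem mem_measL1_iInf {f : Lp ℝ 1 P} {z : ℕ → MeasurableSpace Ω}
    (hz : ∀ n, z n ∈ sigmaFields P) (hf : ∀ n, f ∈ measL1 (z n) P) :
    f ∈ measL1 (⨅ n, z n) P := by
  obtain ⟨g, hg, hgf⟩ := exists_version f
  rw [mem_measL1]
  refine ⟨g, Measurable.stronglyMeasurable ?_, hgf.symm⟩
  intro s hs
  exact MeasurableSpace.measurableSet_iInf.2 fun n =>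
    measurable_of_mem_measL1 (hz n) (hf n) hg hgf hs

theorem inf_mem_sigmaFields (hx : x ∈ sigmaFields P) (hy : y ∈ sigmaFields P) :
    x ⊓ y ∈ sigmaFields P :=
  ⟨inf_le_left.trans hx.1, fun s hs h0 =>
    MeasurableSpace.measurableSet_inf.2 ⟨hx.2 s hs h0, hy.2 s hs h0⟩⟩

theorem sup_mem_sigmaFields (hx : x ∈ sigmaFields P) (hy : y ∈ sigmaFields P) :
    x ⊔ y ∈ sigmaFields P :=
  ⟨sup_le hx.1 hy.1, fun s hs h0 => (le_sup_left : x ≤ x ⊔ y) s (hx.2 s hs h0)⟩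

theorem iInf_mem_sigmaFields {z : ℕ → MeasurableSpace Ω} (hz : ∀ n, z n ∈ sigmaFields P) :
    ⨅ n, z n ∈ sigmaFields P :=
  ⟨(iInf_le z 0).trans (hz 0).1, fun s hs h0 =>
    MeasurableSpace.measurableSet_iInf.2 fun n => (hz n).2 s hs h0⟩

theorem iSup_mem_sigmaFields {z : ℕ → MeasurableSpace Ω} (hz : ∀ n, z n ∈ sigmaFields P) :
    ⨆ n, z n ∈ sigmaFields P :=
  ⟨iSup_le fun n => (hz n).1, fun s hs h0 => le_iSup z 0 s ((hz 0).2 s hs h0)⟩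

theorem trivialField_le (hx : x ∈ sigmaFields P) : trivialField P ≤ x := by
  rintro s ⟨hs, h | h⟩
  · exact hx.2 s hs h
  · have := hx.2 _ hs.compl h
    simpa using this.compl

theorem exists_isProd {f : Lp ℝ 1 P} (hf : BddOne f) (g : Lp ℝ 1 P) : ∃ h, IsProd f g h := by
  have : Integrable (⇑f * ⇑g) P :=
    (L1.integrable_coeFn g).bdd_mul (Lp.aestronglyMeasurable f) hf
  exact ⟨this.toL1 _, this.coeFn_toL1⟩

theorem IsProd.comm {f g h : Lp ℝ 1 P} (hp : IsProd f g h) : IsProd g f h := by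
  unfold IsProd at *
  rwa [mul_comm]

theorem IsProd.mem {f g h : Lp ℝ 1 P} (hp : IsProd f g h) (hf : f ∈ measL1 x P)
    (hg : g ∈ measL1 x P) : h ∈ measL1 x P := by
  rw [mem_measL1] at *
  exact (hf.mul hg).congr (EventuallyEq.symm hp)

theorem norm_eq_integral_abs (f : Lp ℝ 1 P) : ‖f‖ = ∫ ω, |f ω| ∂P := L1.norm_eq_integral_norm f

/-- Makes multiplication continuous in `L₁`; after the splitting below, only `f` and `g'` need
bounds. -/
theorem IsProd.norm_sub_le {f g h f' g' h' : Lp ℝ 1 P} (hp : IsProd f g h)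
    (hp' : IsProd f' g' h') (hf : BddOne f) (hg' : BddOne g') :
    ‖h - h'‖ ≤ ‖f - f'‖ + ‖g - g'‖ := by
  simp only [norm_eq_integral_abs]
  rw [← integral_add (L1.integrable_coeFn _).abs (L1.integrable_coeFn _).abs]
  refine integral_mono_ae (L1.integrable_coeFn _).abs
    ((L1.integrable_coeFn _).abs.add (L1.integrable_coeFn _).abs) ?_
  filter_upwards [hp, hp', hf, hg', Lp.coeFn_sub h h', Lp.coeFn_sub f f', Lp.coeFn_sub g g']
    with ω h1 h2 h3 h4 h5 h6 h7
  simp only [h5, h6, h7, Pi.sub_apply, h1, h2, Pi.mul_apply]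
  have : f ω * g ω - f' ω * g' ω = (f ω - f' ω) * g' ω + f ω * (g ω - g' ω) := by ring
  rw [this]
  refine (abs_add_le _ _).trans ?_
  rw [abs_mul, abs_mul]
  nlinarith [abs_nonneg (f ω - f' ω), abs_nonneg (g ω - g' ω)]

theorem tendsto_isProd {f g h : ℕ → Lp ℝ 1 P} {f' g' h' : Lp ℝ 1 P}
    (hp : ∀ n, IsProd (f n) (g n) (h n)) (hp' : IsProd f' g' h') (hf : ∀ n, BddOne (f n))
    (hg' : BddOne g') (hff : Tendsto f atTop (𝓝 f')) (hgg : Tendsto g atTop (𝓝 g')) :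
    Tendsto h atTop (𝓝 h') := by
  rw [tendsto_iff_norm_sub_tendsto_zero] at *
  refine squeeze_zero (fun n => norm_nonneg _)
    (fun n => (hp n).norm_sub_le hp' (hf n) hg') ?_
  simpa using hff.add hgg

end Basic

/-! ### Conditional expectation operators and indicators. -/

section Op

variable {Ω : Type*} {x y : MeasurableSpace Ω} {mΩ : MeasurableSpace Ω} {P : Measure Ω}
  [IsProbabilityMeasure P]

theorem condOp_ae_eq (hx : x ≤ mΩ) (f : Lp ℝ 1 P) : condOp x P f =ᵐ[P] P[f|x] := by
  rw [condOp, dif_pos hx]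
  have h := condExp_ae_eq_condExpL1CLM hx (L1.integrable_coeFn f)
  rw [Integrable.toL1_coeFn] at h
  exact h.symm

theorem condOp_mem (hx : x ≤ mΩ) (f : Lp ℝ 1 P) : condOp x P f ∈ measL1 x P := by
  rw [mem_measL1]
  exact ⟨_, stronglyMeasurable_condExp, condOp_ae_eq hx f⟩

theorem condOp_of_mem (hx : x ≤ mΩ) {f : Lp ℝ 1 P} (hf : f ∈ measL1 x P) :
    condOp x P f = f := by
  rw [condOp, dif_pos hx]
  exact condExpL1CLM_of_aestronglyMeasurable' f (mem_measL1.1 hf)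

theorem norm_condOp_le (hx : x ≤ mΩ) (f : Lp ℝ 1 P) : ‖condOp x P f‖ ≤ ‖f‖ := by
  rw [Lp.norm_def, Lp.norm_def]
  refine ENNReal.toReal_mono (Lp.eLpNorm_ne_top f) ?_
  rw [eLpNorm_congr_ae (condOp_ae_eq hx f)]
  exact eLpNorm_condExp_le_eLpNorm _ le_rfl

theorem condOp_condOp_of_le (hxy : x ≤ y) (hy : y ≤ mΩ) (f : Lp ℝ 1 P) :
    condOp x P (condOp y P f) = condOp x P f := by
  refine Lp.ext ?_
  refine (condOp_ae_eq (hxy.trans hy) _).trans (EventuallyEq.trans ?_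
    (condOp_ae_eq (hxy.trans hy) _).symm)
  exact (condExp_congr_ae (condOp_ae_eq hy f)).trans (condExp_condExp_of_le hxy hy)

theorem condOp_unique (hx : x ≤ mΩ) {f g : Lp ℝ 1 P} (hg : g ∈ measL1 x P)
    (h : ∀ A, MeasurableSet[x] A → ∫ ω in A, g ω ∂P = ∫ ω in A, f ω ∂P) :
    condOp x P f = g := by
  refine Lp.ext ((condOp_ae_eq hx f).trans (EventuallyEq.symm ?_))
  exact ae_eq_condExp_of_forall_setIntegral_eq hx (L1.integrable_coeFn f)
    (fun s _ _ => (L1.integrable_coeFn g).integrableOn) (fun s hs _ => h s hs) (mem_measL1.1 hg)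

theorem setIntegral_condOp (hx : x ≤ mΩ) (f : Lp ℝ 1 P) {A : Set Ω} (hA : MeasurableSet[x] A) :
    ∫ ω in A, condOp x P f ω ∂P = ∫ ω in A, f ω ∂P := by
  rw [← setIntegral_condExp hx (L1.integrable_coeFn f) hA]
  exact integral_congr_ae (ae_restrict_of_ae (condOp_ae_eq hx f))

theorem ind_ae_eq {A : Set Ω} (hA : MeasurableSet A) :
    ind P hA =ᵐ[P] A.indicator fun _ => (1 : ℝ) := indicatorConstLp_coeFn

theorem ind_mem (hx : x ≤ mΩ) {A : Set Ω} (hA : MeasurableSet[x] A) :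
    ind P (hx A hA) ∈ measL1 x P :=
  mem_lpMeas_indicatorConstLp hx hA _

theorem measurableSet_of_ind_mem (hx : x ∈ sigmaFields P) {A : Set Ω} (hA : MeasurableSet A)
    (h : ind P hA ∈ measL1 x P) : MeasurableSet[x] A := by
  have h1 := measurable_of_mem_measL1 hx h (measurable_const.indicator hA) (ind_ae_eq hA).symm
  have h2 := h1 (measurableSet_singleton (1 : ℝ))
  convert h2 using 1
  ext ω
  by_cases hω : ω ∈ A <;> simp [hω]

theorem le_of_forall_measL1_le (hx : x ≤ mΩ) (hy : y ∈ sigmaFields P)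
    (h : measL1 x P ≤ measL1 y P) : x ≤ y := fun A hA =>
  measurableSet_of_ind_mem hy (hx A hA) (h (ind_mem hx hA))

theorem integral_ind {A : Set Ω} (hA : MeasurableSet A) : ∫ ω, ind P hA ω ∂P = P.real A := by
  rw [integral_congr_ae (ind_ae_eq hA), integral_indicator_const _ hA, smul_eq_mul, mul_one]

theorem bddOne_ind {A : Set Ω} (hA : MeasurableSet A) : BddOne (ind P hA) := by
  filter_upwards [ind_ae_eq (P := P) hA] with ω hω
  rw [hω]
  by_cases h : ω ∈ A <;> simp [h]

theorem BddOne.condOp (hx : x ≤ mΩ) {f : Lp ℝ 1 P} (hf : BddOne f) : BddOne (condOp x P f) := by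
  have := ae_bdd_abs_condExp_of_ae_bdd_abs (m := x) (R := 1) (f := f) hf
  filter_upwards [this, condOp_ae_eq hx f] with ω h1 h2
  rw [h2]
  exact h1

theorem isProd_ind {A D : Set Ω} (hA : MeasurableSet A) (hD : MeasurableSet D) :
    IsProd (ind P hA) (ind P hD) (ind P (hA.inter hD)) := by
  filter_upwards [ind_ae_eq (P := P) hA, ind_ae_eq (P := P) hD, ind_ae_eq (P := P) (hA.inter hD)]
    with ω h1 h2 h3
  rw [h3, Pi.mul_apply, h1, h2]
  by_cases h : ω ∈ A <;> by_cases h' : ω ∈ D <;> simp [h, h']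

theorem IsProd.condOp (hx : x ≤ mΩ) {f g h : Lp ℝ 1 P} (hp : IsProd f g h)
    (hf : f ∈ measL1 x P) : IsProd f (condOp x P g) (condOp x P h) := by
  have hi : Integrable (⇑f * ⇑g) P := (L1.integrable_coeFn h).congr hp
  have h1 := condExp_mul_of_aestronglyMeasurable_left (mem_measL1.1 hf) hi (L1.integrable_coeFn g)
  refine (condOp_ae_eq hx h).trans ((condExp_congr_ae hp).trans (h1.trans ?_))
  exact EventuallyEq.mul EventuallyEq.rfl (condOp_ae_eq hx g).symm

/-- A closed subspace containing the products of indicators from `x` and from `y` contains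
all `x ⊔ y`-measurable functions. -/
theorem mem_of_forall_inter (hx : x ≤ mΩ) (hy : y ≤ mΩ) (K : Submodule ℝ (Lp ℝ 1 P))
    (hK : IsClosed (K : Set (Lp ℝ 1 P)))
    (h : ∀ A D, ∀ hA : MeasurableSet[x] A, ∀ hD : MeasurableSet[y] D,
      ind P ((hx A hA).inter (hy D hD)) ∈ K) {f : Lp ℝ 1 P} (hf : f ∈ measL1 (x ⊔ y) P) :
    f ∈ K := by
  have hxy : x ⊔ y ≤ mΩ := sup_le hx hy
  have hset : ∀ S, ∀ hS : MeasurableSet[x ⊔ y] S, ind P (hxy S hS) ∈ K := by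
    let s : Set (Set Ω) := Set.image2 (· ∩ ·) {A | MeasurableSet[x] A} {D | MeasurableSet[y] D}
    have hgen : x ⊔ y = MeasurableSpace.generateFrom s := by
      refine le_antisymm (sup_le (fun A hA => ?_) fun D hD => ?_)
        (MeasurableSpace.generateFrom_le ?_)
      · exact MeasurableSpace.measurableSet_generateFrom
          ⟨A, hA, Set.univ, @MeasurableSet.univ _ y, Set.inter_univ A⟩
      · exact MeasurableSpace.measurableSet_generateFrom
          ⟨Set.univ, @MeasurableSet.univ _ x, D, hD, Set.univ_inter D⟩
      · rintro _ ⟨A, hA, D, hD, rfl⟩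
        exact MeasurableSet.inter ((le_sup_left : x ≤ x ⊔ y) A hA)
          ((le_sup_right : y ≤ x ⊔ y) D hD)
    have hpi : IsPiSystem s := by
      rintro _ ⟨A, hA, D, hD, rfl⟩ _ ⟨A', hA', D', hD', rfl⟩ _
      exact ⟨A ∩ A', MeasurableSet.inter hA hA', D ∩ D', MeasurableSet.inter hD hD',
        Set.inter_inter_inter_comm A A' D D'⟩
    have huniv : ind P (MeasurableSet.univ : MeasurableSet[mΩ] _) ∈ K := by
      have := h Set.univ Set.univ (@MeasurableSet.univ _ x) (@MeasurableSet.univ _ y)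
      convert this using 2
      simp
    intro S hS
    refine MeasurableSpace.induction_on_inter (C := fun S hS => ind P (hxy S hS) ∈ K) hgen hpi
      ?_ ?_ ?_ ?_ S hS
    · have : ind P (MeasurableSet.empty : MeasurableSet[mΩ] _) = 0 := indicatorConstLp_empty
      exact this ▸ K.zero_mem
    · rintro _ ⟨A, hA, D, hD, rfl⟩
      exact h A D hA hD
    · intro t ht hmem
      have : ind P (hxy _ ht.compl) = ind P (MeasurableSet.univ : MeasurableSet[mΩ] _)
          - ind P (hxy _ ht) := by
        refine Lp.ext ((ind_ae_eq _).trans (EventuallyEq.trans ?_ (Lp.coeFn_sub _ _).symm))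
        filter_upwards [ind_ae_eq (P := P) (hxy _ ht),
          ind_ae_eq (P := P) (MeasurableSet.univ : MeasurableSet[mΩ] _)] with ω h1 h2
        rw [Pi.sub_apply, h1, h2]
        by_cases hω : ω ∈ t <;> simp [hω]
      rw [this]
      exact K.sub_mem huniv hmem
    · intro F hd hF hmem
      -- Finite disjoint unions stay in `K` by additivity; the countable union follows because `K`
      -- is closed and the measure of the remainder tends to zero.
      have hfin : ∀ n, ∀ hm : MeasurableSet[mΩ] (Set.accumulate F n), ind P hm ∈ K := by
        intro n
        induction n with
        | zero =>
          intro hm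
          convert hmem 0 using 2
          simp [Set.accumulate]
        | succ n ih =>
          intro hm
          have hm' : MeasurableSet[mΩ] (Set.accumulate F n) :=
            MeasurableSet.biUnion (Set.to_countable _) fun i _ => hxy _ (hF i)
          have hdis : Disjoint (Set.accumulate F n) (F (n + 1)) :=
            Set.disjoint_accumulate hd (Nat.lt_succ_self n)
          have hu := indicatorConstLp_disjoint_union (p := 1) hm' (hxy _ (hF (n + 1)))
            (measure_ne_top P _) (measure_ne_top P _) hdis (1 : ℝ)
          have : ind P hm = ind P hm' + ind P (hxy _ (hF (n + 1))) := by
            refine Eq.trans ?_ hu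
            unfold ind
            congr 1
            exact Set.accumulate_succ F n
          rw [this]
          exact K.add_mem (ih hm') (hmem _)
      have hm : ∀ n, MeasurableSet[mΩ] (Set.accumulate F n) := fun n =>
        MeasurableSet.biUnion (Set.to_countable _) fun i _ => hxy _ (hF i)
      refine hK.mem_of_tendsto (b := atTop) (f := fun n => ind P (hm n)) ?_
        (Eventually.of_forall fun n => hfin n (hm n))
      refine tendsto_indicatorConstLp_set (by simp) ?_
      have hmU : MeasurableSet[mΩ] (⋃ n, F n) := MeasurableSet.iUnion fun i => hxy _ (hF i)
      have h1 : ∀ n, symmDiff (Set.accumulate F n) (⋃ n, F n)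
          = (⋃ n, F n) \ Set.accumulate F n := fun n => by
        rw [symmDiff_def, sdiff_eq_bot_iff.2 (Set.accumulate_subset_iUnion n), bot_sup_eq]
      simp only [h1]
      have h2 := tendsto_measure_iInter_atTop (μ := P)
        (s := fun n => (⋃ n, F n) \ Set.accumulate F n)
        (fun n => (hmU.diff (hm n)).nullMeasurableSet)
        (fun i j hij => Set.sdiff_subset_sdiff_right (Set.monotone_accumulate hij))
        ⟨0, measure_ne_top P _⟩
      rwa [← Set.sdiff_iUnion, Set.iUnion_accumulate, Set.sdiff_self, measure_empty] at h2
  refine Lp.induction_stronglyMeasurable hxy (by simp) (fun f => f ∈ K) ?_ ?_ ?_ f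
    (mem_measL1.1 hf)
  · intro c s hs hμs
    have : (Lp.simpleFunc.indicatorConst 1 (hxy s hs) hμs.ne c : Lp ℝ 1 P)
        = c • ind P (hxy s hs) := by
      rw [Lp.simpleFunc.coe_indicatorConst]
      refine Lp.ext (indicatorConstLp_coeFn.trans (EventuallyEq.trans ?_ (Lp.coeFn_smul _ _).symm))
      filter_upwards [ind_ae_eq (P := P) (hxy s hs)] with ω h1
      rw [Pi.smul_apply, h1]
      by_cases hω : ω ∈ s <;> simp [hω]
    rw [this]
    exact K.smul_mem _ (hset s hs)
  · intro f g hf hg _ _ _ h1 h2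
    exact K.add_mem h1 h2
  · exact hK.preimage continuous_subtype_val

end Op

/-! ### Strong convergence and martingale limits. -/

/-- Strong convergence of the conditional expectation operators. -/
def StrongTendsto {Ω : Type*} {mΩ : MeasurableSpace Ω} (P : Measure Ω) [IsProbabilityMeasure P]
    (u : ℕ → MeasurableSpace Ω) (x : MeasurableSpace Ω) : Prop :=
  ∀ f : Lp ℝ 1 P, Tendsto (fun n => condOp (u n) P f) atTop (𝓝 (condOp x P f))

/-- The sequential closure of `B` in the strong operator topology. -/
def strongClosure {Ω : Type*} {mΩ : MeasurableSpace Ω} (P : Measure Ω) [IsProbabilityMeasure P]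
    (B : Set (MeasurableSpace Ω)) : Set (MeasurableSpace Ω) :=
  {x | x ∈ sigmaFields P ∧ ∃ u : ℕ → MeasurableSpace Ω, (∀ n, u n ∈ B) ∧ StrongTendsto P u x}

/-- The conditional expectations given two elements of `S` compose to the one given their
intersection. -/
def IsCommuting {Ω : Type*} {mΩ : MeasurableSpace Ω} (P : Measure Ω) [IsProbabilityMeasure P]
    (S : Set (MeasurableSpace Ω)) : Prop :=
  ∀ x ∈ S, ∀ y ∈ S, ∀ f : Lp ℝ 1 P, condOp x P (condOp y P f) = condOp (x ⊓ y) P f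

section Strong

variable {Ω : Type*} {x y : MeasurableSpace Ω} {mΩ : MeasurableSpace Ω} {P : Measure Ω}
  [IsProbabilityMeasure P]

/-- Commutation makes the composite measurable for both `x` and `y`, hence fixed by `E_{x ⊓ y}`; the
tower property then absorbs the two operators. -/
theorem condOp_inf_of_commute (hx : x ∈ sigmaFields P) (hy : y ∈ sigmaFields P)
    (h : ∀ f : Lp ℝ 1 P, condOp x P (condOp y P f) = condOp y P (condOp x P f))
    (f : Lp ℝ 1 P) : condOp x P (condOp y P f) = condOp (x ⊓ y) P f := by
  have hxy := inf_mem_sigmaFields hx hy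
  have h1 : condOp x P (condOp y P f) ∈ measL1 (x ⊓ y) P :=
    mem_measL1_inf hx hy (condOp_mem hx.1 _) (h f ▸ condOp_mem hy.1 _)
  rw [← condOp_of_mem hxy.1 h1, condOp_condOp_of_le inf_le_left hx.1,
    condOp_condOp_of_le inf_le_right hy.1]

theorem norm_condOp_sub_le (hx : x ≤ mΩ) (f g : Lp ℝ 1 P) :
    ‖condOp x P f - condOp x P g‖ ≤ ‖f - g‖ := by
  rw [← map_sub]; exact norm_condOp_le hx _

theorem StrongTendsto.apply {u : ℕ → MeasurableSpace Ω} (h : StrongTendsto P u x)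
    (hu : ∀ n, u n ≤ mΩ) {g : ℕ → Lp ℝ 1 P} {f : Lp ℝ 1 P} (hg : Tendsto g atTop (𝓝 f)) :
    Tendsto (fun n => condOp (u n) P (g n)) atTop (𝓝 (condOp x P f)) := by
  have h1 : Tendsto (fun n => condOp (u n) P (g n) - condOp (u n) P f) atTop (𝓝 0) := by
    refine squeeze_zero_norm (fun n => norm_condOp_sub_le (hu n) _ _) ?_
    exact tendsto_iff_norm_sub_tendsto_zero.1 hg
  simpa using h1.add (h f)

/-- The functions on which conditional expectations converge form a closed subspace. -/
theorem exists_closed_submodule_tendsto {u : ℕ → MeasurableSpace Ω} (hu : ∀ n, u n ≤ mΩ)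
    (hx : x ≤ mΩ) : ∃ K : Submodule ℝ (Lp ℝ 1 P), IsClosed (K : Set (Lp ℝ 1 P)) ∧
      ∀ f, f ∈ K ↔ Tendsto (fun n => condOp (u n) P f) atTop (𝓝 (condOp x P f)) := by
  let K : Submodule ℝ (Lp ℝ 1 P) :=
    { carrier := {f | Tendsto (fun n => condOp (u n) P f) atTop (𝓝 (condOp x P f))}
      add_mem' := fun {a b} ha hb => by
        simp only [Set.mem_ofPred_eq, map_add] at *
        exact ha.add hb
      zero_mem' := by simp
      smul_mem' := fun c a ha => by
        simp only [Set.mem_ofPred_eq, map_smul] at *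
        exact ha.const_smul c }
  refine ⟨K, ?_, fun f => Iff.rfl⟩
  refine isClosed_of_closure_subset fun f hf => ?_
  change Tendsto _ _ _
  rw [Metric.tendsto_atTop]
  intro ε hε
  obtain ⟨g, hg, hfg⟩ := Metric.mem_closure_iff.1 hf (ε / 3) (by positivity)
  obtain ⟨N, hN⟩ := Metric.tendsto_atTop.1 (show Tendsto _ _ _ from hg) (ε / 3) (by positivity)
  refine ⟨N, fun n hn => ?_⟩
  have h1 : dist (condOp (u n) P f) (condOp (u n) P g) ≤ dist f g := by
    simp only [dist_eq_norm]; exact norm_condOp_sub_le (hu n) _ _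
  have h2 : dist (condOp x P g) (condOp x P f) ≤ dist f g := by
    rw [dist_comm]; simp only [dist_eq_norm]; exact norm_condOp_sub_le hx _ _
  have h3 := dist_triangle4 (condOp (u n) P f) (condOp (u n) P g) (condOp x P g) (condOp x P f)
  have := hN n hn
  linarith

theorem strongTendsto_of_dense {u : ℕ → MeasurableSpace Ω} (hu : ∀ n, u n ≤ mΩ)
    (hx : x ≤ mΩ) {s : Set (Lp ℝ 1 P)} (hs : Dense s)
    (h : ∀ f ∈ s, Tendsto (fun n => condOp (u n) P f) atTop (𝓝 (condOp x P f))) :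
    StrongTendsto P u x := fun f => by
  obtain ⟨K, hK, hmem⟩ := exists_closed_submodule_tendsto (P := P) hu hx
  exact (hmem f).1 (hK.closure_subset_iff.2 (fun g hg => (hmem g).2 (h g hg)) (hs f))

theorem strongTendsto_of_forall_inter {u : ℕ → MeasurableSpace Ω} (hu : ∀ n, u n ≤ mΩ)
    {z : MeasurableSpace Ω} (hz : z ≤ mΩ) (hx : x ≤ mΩ) (hy : y ≤ mΩ) (hxy : x ⊔ y = mΩ)
    (h : ∀ A D, ∀ hA : MeasurableSet[x] A, ∀ hD : MeasurableSet[y] D,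
      Tendsto (fun n => condOp (u n) P (ind P ((hx A hA).inter (hy D hD)))) atTop
        (𝓝 (condOp z P (ind P ((hx A hA).inter (hy D hD)))))) :
    StrongTendsto P u z := fun f => by
  obtain ⟨K, hK, hmem⟩ := exists_closed_submodule_tendsto (P := P) hu hz
  refine (hmem f).1 (mem_of_forall_inter hx hy K hK (fun A D hA hD => (hmem _).2 (h A D hA hD)) ?_)
  rw [hxy, mem_measL1]
  exact Lp.aestronglyMeasurable f

theorem strongTendsto_iSup {z : ℕ → MeasurableSpace Ω} (hz : ∀ n, z n ≤ mΩ) (hm : Monotone z) :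
    StrongTendsto P z (⨆ n, z n) := fun f => by
  have h := tendsto_eLpNorm_condExp (ℱ := ⟨z, hm, hz⟩) (μ := P) f
  rw [tendsto_iff_norm_sub_tendsto_zero]
  have h2 := (ENNReal.tendsto_toReal ENNReal.zero_ne_top).comp h
  refine h2.congr fun n => ?_
  rw [Lp.norm_def, Function.comp_apply]
  congr 1
  refine eLpNorm_congr_ae ?_
  refine EventuallyEq.symm ((Lp.coeFn_sub _ _).trans ?_)
  exact (condOp_ae_eq (hz n) f).sub (condOp_ae_eq (iSup_le hz) f)

theorem integral_abs_sq_le {f : Ω → ℝ} (hf : MemLp f 2 P) :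
    (∫ ω, |f ω| ∂P) ^ 2 ≤ ∫ ω, f ω ^ 2 ∂P := by
  have h1 : Integrable (fun ω => |f ω|) P := (hf.integrable (by norm_num)).abs
  have h2 : Integrable (fun ω => f ω ^ 2) P := hf.integrable_sq
  set c := ∫ ω, |f ω| ∂P with hc
  have h3 : 0 ≤ ∫ ω, (f ω ^ 2 - 2 * c * |f ω| + c ^ 2) ∂P := by
    refine integral_nonneg fun ω => ?_
    have := sq_nonneg (|f ω| - c)
    rw [← sq_abs (f ω)]
    simp only [Pi.zero_apply]
    nlinarith
  have h4 : Integrable (fun ω => f ω ^ 2 - 2 * c * |f ω|) P := h2.sub (h1.const_mul _)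
  rw [integral_add h4 (integrable_const _),
    integral_sub h2 (h1.const_mul _), integral_const_mul, integral_const] at h3
  simp only [probReal_univ, smul_eq_mul, one_mul, ← hc] at h3
  nlinarith

theorem BddOne.memLp {f : Lp ℝ 1 P} (hf : BddOne f) : MemLp f 2 P :=
  (memLp_top_of_bound (Lp.aestronglyMeasurable f) 1 hf).mono_exponent le_top

theorem integral_condOp_mul (hx : x ≤ mΩ) {f g : Lp ℝ 1 P} (hf : BddOne f)
    (hfx : f ∈ measL1 x P) : ∫ ω, f ω * condOp x P g ω ∂P = ∫ ω, f ω * g ω ∂P := by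
  obtain ⟨h, hh⟩ := exists_isProd hf g
  have h2 := hh.condOp hx hfx
  have e1 : ∫ ω, f ω * condOp x P g ω ∂P = ∫ ω, condOp x P h ω ∂P :=
    integral_congr_ae (EventuallyEq.symm h2)
  have e2 : ∫ ω, f ω * g ω ∂P = ∫ ω, h ω ∂P := integral_congr_ae (EventuallyEq.symm hh)
  rw [e1, e2]
  simpa using setIntegral_condOp hx h (A := Set.univ) (@MeasurableSet.univ _ x)

/-- The `L₁` norm is at most the `L₂` norm, and Pythagoras applies in `L₂`. -/
theorem sq_norm_condOp_sub_le (hxy : x ≤ y) (hy : y ≤ mΩ) {f : Lp ℝ 1 P} (hf : BddOne f) :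
    ‖condOp y P f - condOp x P f‖ ^ 2
      ≤ ∫ ω, condOp y P f ω ^ 2 ∂P - ∫ ω, condOp x P f ω ^ 2 ∂P := by
  have hx := hxy.trans hy
  have bx := hf.condOp hx
  have by' := hf.condOp hy
  have hm := by'.memLp.sub bx.memLp
  have e : ‖condOp y P f - condOp x P f‖ = ∫ ω, |condOp y P f ω - condOp x P f ω| ∂P := by
    rw [norm_eq_integral_abs]
    refine integral_congr_ae ?_
    filter_upwards [Lp.coeFn_sub (condOp y P f) (condOp x P f)] with ω h
    rw [h, Pi.sub_apply]
  rw [e]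
  refine (integral_abs_sq_le hm).trans (le_of_eq ?_)
  have h1 := integral_condOp_mul hx (g := condOp y P f) bx (condOp_mem hx f)
  rw [condOp_condOp_of_le hxy hy] at h1
  have i1 := by'.memLp.integrable_sq
  have i2 := bx.memLp.integrable_sq
  have i3 : Integrable (fun ω => condOp x P f ω * condOp y P f ω) P :=
    bx.memLp.integrable_mul by'.memLp
  have e2 : (fun ω => (condOp y P f ω - condOp x P f ω) ^ 2) = fun ω =>
      condOp y P f ω ^ 2 - 2 * (condOp x P f ω * condOp y P f ω) + condOp x P f ω ^ 2 := by
    ext ω; ring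
  have i4 : Integrable (fun ω => condOp y P f ω ^ 2
      - 2 * (condOp x P f ω * condOp y P f ω)) P := i1.sub (i3.const_mul _)
  simp only [Pi.sub_apply]
  rw [e2, integral_add i4 i2, integral_sub i1 (i3.const_mul _),
    integral_const_mul, ← h1]
  simp only [← sq]
  ring

/-- Reverse martingale convergence: the `L₂` energies decrease, so the projections form a Cauchy
sequence, and the limit is measurable for every `z n`. -/
theorem strongTendsto_iInf {z : ℕ → MeasurableSpace Ω} (hz : ∀ n, z n ∈ sigmaFields P)
    (hm : Antitone z) : StrongTendsto P z (⨅ n, z n) := by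
  have hzle : ∀ n, z n ≤ mΩ := fun n => (hz n).1
  have hy := iInf_mem_sigmaFields hz
  -- With both generating σ-fields equal to `mΩ`, this reduces to indicators, which are bounded and
  -- so lie in `L₂`.
  refine strongTendsto_of_forall_inter hzle hy.1 le_rfl le_rfl (sup_idem _) fun A D hA hD => ?_
  set f := ind P ((le_refl mΩ A hA).inter (le_refl mΩ D hD))
  have hf : BddOne f := bddOne_ind _
  have hc : CauchySeq fun n => condOp (z n) P f := by
    set a : ℕ → ℝ := fun n => ∫ ω, condOp (z n) P f ω ^ 2 ∂P with ha
    have hle : ∀ m n, m ≤ n → ‖condOp (z m) P f - condOp (z n) P f‖ ^ 2 ≤ a m - a n :=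
      fun m n hmn => sq_norm_condOp_sub_le (hm hmn) (hzle m) hf
    have hanti : Antitone a := fun m n hmn => by
      have := hle m n hmn
      nlinarith [sq_nonneg ‖condOp (z m) P f - condOp (z n) P f‖]
    have hlim := tendsto_atTop_ciInf hanti
      ⟨0, by rintro _ ⟨n, rfl⟩; exact integral_nonneg fun ω => sq_nonneg _⟩
    rw [Metric.cauchySeq_iff']
    intro ε hε
    obtain ⟨N, hN⟩ := Metric.cauchySeq_iff'.1 hlim.cauchySeq (ε ^ 2) (by positivity)
    refine ⟨N, fun n hn => ?_⟩
    have h1 := hle N n hn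
    have h2 := hN n hn
    rw [Real.dist_eq, abs_sub_comm] at h2
    have h3 := (h1.trans (le_abs_self _)).trans_lt h2
    rw [dist_comm, dist_eq_norm]
    exact lt_of_pow_lt_pow_left₀ 2 hε.le h3
  obtain ⟨g, hg⟩ := cauchySeq_tendsto_of_complete hc
  have hgm : g ∈ measL1 (⨅ n, z n) P := by
    refine mem_measL1_iInf hz fun n => ?_
    refine (isClosed_measL1 (hzle n)).mem_of_tendsto hg ?_
    filter_upwards [eventually_ge_atTop n] with k hk
    exact measL1_mono (hm hk) (condOp_mem (hzle k) f)
  have h1 : Tendsto (fun n => condOp (⨅ n, z n) P (condOp (z n) P f)) atTop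
      (𝓝 (condOp (⨅ n, z n) P g)) := ((condOp _ P).continuous.tendsto g).comp hg
  simp only [fun n => condOp_condOp_of_le (iInf_le z n) (hzle n) f] at h1
  rw [condOp_of_mem hy.1 hgm] at h1
  rwa [← tendsto_nhds_unique tendsto_const_nhds h1] at hg

theorem separableSpace_L1 [h : TopologicalSpace.SeparableSpace (Lp ℝ 2 P)] :
    TopologicalSpace.SeparableSpace (Lp ℝ 1 P) := by
  let φ : Lp ℝ 2 P →ₗ[ℝ] Lp ℝ 1 P :=
    { toFun := fun f => ⟨f.1, Lp.antitone (by norm_num) f.2⟩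
      map_add' := fun _ _ => rfl
      map_smul' := fun _ _ => rfl }
  have hφ : Continuous φ := by
    refine AddMonoidHomClass.continuous_of_bound φ 1 fun f => ?_
    rw [one_mul, Lp.norm_def, Lp.norm_def]
    refine ENNReal.toReal_mono (Lp.eLpNorm_ne_top f) ?_
    exact eLpNorm_le_eLpNorm_of_exponent_le (by norm_num) (Lp.aestronglyMeasurable f)
  have hd : DenseRange φ := by
    intro f
    have hf : f ∈ measL1 (mΩ ⊔ mΩ) P := by
      rw [sup_idem, mem_measL1]; exact Lp.aestronglyMeasurable f
    have := mem_of_forall_inter le_rfl le_rfl (LinearMap.range φ).topologicalClosure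
      (Submodule.isClosed_topologicalClosure _) (fun A D hA hD => ?_) hf
    · exact this
    · refine Submodule.le_topologicalClosure _
        ⟨indicatorConstLp 2 (hA.inter hD) (measure_ne_top P _) 1, ?_⟩
      rfl
  exact hd.separableSpace hφ

end Strong

/-! ### Lower limits are the strong limits. -/

/-- The intersection of the first `k + 1` terms of a sequence. -/
def prefixInf {Ω : Type*} (v : ℕ → MeasurableSpace Ω) : ℕ → MeasurableSpace Ω
  | 0 => v 0
  | k + 1 => prefixInf v k ⊓ v (k + 1)

theorem prefixInf_antitone {Ω : Type*} (v : ℕ → MeasurableSpace Ω) : Antitone (prefixInf v) :=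
  antitone_nat_of_succ_le fun _ => inf_le_left

theorem iInf_prefixInf {Ω : Type*} (v : ℕ → MeasurableSpace Ω) :
    ⨅ k, prefixInf v k = ⨅ k, v k := by
  refine le_antisymm (le_iInf fun k => (iInf_le _ k).trans ?_) (le_iInf fun k => ?_)
  · cases k with
    | zero => exact le_rfl
    | succ k => exact inf_le_right
  · induction k with
    | zero => exact iInf_le v 0
    | succ k ih => exact le_inf ih (iInf_le v _)

theorem prefixInf_mem {Ω : Type*} {S : Set (MeasurableSpace Ω)}
    (hS : ∀ x ∈ S, ∀ y ∈ S, x ⊓ y ∈ S) {v : ℕ → MeasurableSpace Ω} (hv : ∀ n, v n ∈ S) (k : ℕ) :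
    prefixInf v k ∈ S := by
  induction k with
  | zero => exact hv 0
  | succ k ih => exact hS _ ih _ (hv _)

section Closure

variable {Ω : Type*} {x y : MeasurableSpace Ω} {mΩ : MeasurableSpace Ω} {P : Measure Ω}
  [IsProbabilityMeasure P] {B : Set (MeasurableSpace Ω)}

theorem strongClosure_subset_sigmaFields : strongClosure P B ⊆ sigmaFields P := fun _ h => h.1

theorem subset_strongClosure (hB : B ⊆ sigmaFields P) : B ⊆ strongClosure P B := fun x hx =>
  ⟨hB hx, fun _ => x, fun _ => hx, fun _ => tendsto_const_nhds⟩

/-- The operators of `u n ⊓ v n` converge to `E_x E_y` and also to `E_y E_x`, so these commute. -/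
theorem StrongTendsto.inf (hB : B ⊆ sigmaFields P) (hc : IsCommuting P B)
    {u v : ℕ → MeasurableSpace Ω} (hu : ∀ n, u n ∈ B) (hv : ∀ n, v n ∈ B)
    (hx : x ∈ sigmaFields P) (hy : y ∈ sigmaFields P)
    (hux : StrongTendsto P u x) (hvy : StrongTendsto P v y) :
    (∀ f : Lp ℝ 1 P, condOp x P (condOp y P f) = condOp (x ⊓ y) P f) ∧
      StrongTendsto P (fun n => u n ⊓ v n) (x ⊓ y) := by
  have h1 : ∀ f : Lp ℝ 1 P, Tendsto (fun n => condOp (u n ⊓ v n) P f) atTop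
      (𝓝 (condOp x P (condOp y P f))) := fun f =>
    (hux.apply (fun n => (hB (hu n)).1) (hvy f)).congr fun n => hc _ (hu n) _ (hv n) f
  have h2 : ∀ f : Lp ℝ 1 P, Tendsto (fun n => condOp (u n ⊓ v n) P f) atTop
      (𝓝 (condOp y P (condOp x P f))) := fun f =>
    (hvy.apply (fun n => (hB (hv n)).1) (hux f)).congr fun n => by
      rw [hc _ (hv n) _ (hu n) f, inf_comm]
  have h3 := condOp_inf_of_commute hx hy fun f => tendsto_nhds_unique (h1 f) (h2 f)
  exact ⟨h3, fun f => h3 f ▸ h1 f⟩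

theorem strongClosure_isCommuting (hB : B ⊆ sigmaFields P) (hc : IsCommuting P B) :
    IsCommuting P (strongClosure P B) := by
  rintro x ⟨hx, u, hu, hux⟩ y ⟨hy, v, hv, hvy⟩
  exact (StrongTendsto.inf hB hc hu hv hx hy hux hvy).1

theorem strongClosure_inf_mem (hB : B ⊆ sigmaFields P) (hc : IsCommuting P B)
    (hinf : ∀ x ∈ B, ∀ y ∈ B, x ⊓ y ∈ B) :
    ∀ x ∈ strongClosure P B, ∀ y ∈ strongClosure P B, x ⊓ y ∈ strongClosure P B := by
  rintro x ⟨hx, u, hu, hux⟩ y ⟨hy, v, hv, hvy⟩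
  exact ⟨inf_mem_sigmaFields hx hy, fun n => u n ⊓ v n, fun n => hinf _ (hu n) _ (hv n),
    (StrongTendsto.inf hB hc hu hv hx hy hux hvy).2⟩

theorem StrongTendsto.exists_forall_norm_lt {u : ℕ → MeasurableSpace Ω}
    (hux : StrongTendsto P u x) (F : ℕ → Lp ℝ 1 P) (n : ℕ) {ε : ℝ} (hε : 0 < ε) :
    ∃ k ≥ n, ∀ i ≤ n, ‖condOp (u k) P (F i) - condOp x P (F i)‖ < ε := by
  have h : ∀ᶠ k in atTop, ∀ i ∈ Finset.range (n + 1),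
      ‖condOp (u k) P (F i) - condOp x P (F i)‖ < ε := by
    rw [Filter.eventually_all_finset]
    intro i _
    have := tendsto_iff_norm_sub_tendsto_zero.1 (hux (F i))
    exact this.eventually_lt_const hε
  obtain ⟨k, hk, hkn⟩ := (h.and (eventually_ge_atTop n)).exists
  exact ⟨k, hkn, fun i hi => hk i (Finset.mem_range.2 (Nat.lt_succ_of_le hi))⟩

theorem exists_mem_forall_norm_lt (hx : x ∈ strongClosure P B) (F : ℕ → Lp ℝ 1 P) (n : ℕ)
    {ε : ℝ} (hε : 0 < ε) :
    ∃ b ∈ B, ∀ i ≤ n, ‖condOp b P (F i) - condOp x P (F i)‖ < ε := by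
  obtain ⟨-, u, hu, hux⟩ := hx
  obtain ⟨k, -, hk⟩ := hux.exists_forall_norm_lt F n hε
  exact ⟨u k, hu k, hk⟩

/-- Diagonal argument: the `n`-th approximant is chosen to be accurate on the first `n + 1`
functions of a dense sequence. -/
theorem strongClosure_idem [TopologicalSpace.SeparableSpace (Lp ℝ 2 P)]
    (hB : B ⊆ sigmaFields P) : strongClosure P (strongClosure P B) ⊆ strongClosure P B := by
  intro x hx
  have := separableSpace_L1 (P := P)
  let F := TopologicalSpace.denseSeq (Lp ℝ 1 P)
  have hε : ∀ n : ℕ, (0 : ℝ) < 1 / (n + 1) := fun n => Nat.one_div_pos_of_nat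
  choose v hv hvx using fun n : ℕ => exists_mem_forall_norm_lt hx F n (hε n)
  choose w hw hwv using fun n : ℕ => exists_mem_forall_norm_lt (hv n) F n (hε n)
  refine ⟨hx.1, w, hw, strongTendsto_of_dense (fun n => (hB (hw n)).1) hx.1.1
    (TopologicalSpace.denseRange_denseSeq _) ?_⟩
  rintro _ ⟨i, rfl⟩
  rw [tendsto_iff_norm_sub_tendsto_zero]
  have hlim : Tendsto (fun n : ℕ => 1 / ((n : ℝ) + 1) + 1 / ((n : ℝ) + 1)) atTop (𝓝 0) := by
    simpa using tendsto_one_div_add_atTop_nhds_zero_nat.add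
      (tendsto_one_div_add_atTop_nhds_zero_nat (𝕜 := ℝ))
  refine squeeze_zero' (Eventually.of_forall fun n => norm_nonneg _) ?_ hlim
  filter_upwards [eventually_ge_atTop i] with n hn
  have := norm_sub_le_norm_sub_add_norm_sub (condOp (w n) P (F i)) (condOp (v n) P (F i))
    (condOp x P (F i))
  exact this.trans (add_le_add (hwv n i hn).le (hvx n i hn).le)

/-- Tail infima are decreasing limits of finite meets in `B`, and the lower limit is an increasing
limit of those; idempotence merges the two limits. -/
theorem closure_subset_strongClosure [TopologicalSpace.SeparableSpace (Lp ℝ 2 P)]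
    (hB : B ⊆ sigmaFields P) (hinf : ∀ x ∈ B, ∀ y ∈ B, x ⊓ y ∈ B) :
    closure B ⊆ strongClosure P B := by
  rintro _ ⟨u, hu, rfl⟩
  have hmem : ∀ n, ⨅ k, u (n + k) ∈ strongClosure P B := fun n => by
    rw [← iInf_prefixInf fun k => u (n + k)]
    have h := prefixInf_mem hinf fun k => hu (n + k)
    exact ⟨iInf_mem_sigmaFields fun k => hB (h k), _, h,
      strongTendsto_iInf (fun k => hB (h k)) (prefixInf_antitone _)⟩
  refine strongClosure_idem hB ⟨iSup_mem_sigmaFields fun n => (hmem n).1, _, hmem,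
    strongTendsto_iSup (fun n => (hmem n).1.1) (monotone_nat_of_le_succ fun n => ?_)⟩
  refine le_iInf fun k => (iInf_le _ (k + 1)).trans (le_of_eq ?_)
  congr 1
  ring

/-- Operators of meets are products of contractions, so errors add up; the bound is the partial sum
`ε + ε/2 + … + ε/2^k`. -/
theorem norm_prefixInf_sub_le (hB : B ⊆ sigmaFields P) (hc : IsCommuting P B)
    (hinf : ∀ x ∈ B, ∀ y ∈ B, x ⊓ y ∈ B) {v : ℕ → MeasurableSpace Ω} (hv : ∀ n, v n ∈ B)
    {g : Lp ℝ 1 P} {ε : ℝ} (h : ∀ k, ‖condOp (v k) P g - g‖ ≤ ε / 2 ^ k) (k : ℕ) :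
    ‖condOp (prefixInf v k) P g - g‖ ≤ 2 * ε - ε / 2 ^ k := by
  induction k with
  | zero => have := h 0; simp only [pow_zero, div_one] at *; exact this.trans (by linarith)
  | succ k ih =>
    have hp := prefixInf_mem hinf hv k
    have e : condOp (prefixInf v (k + 1)) P g - g
        = (condOp (prefixInf v k) P (condOp (v (k + 1)) P g) - condOp (prefixInf v k) P g)
          + (condOp (prefixInf v k) P g - g) := by
      rw [hc _ hp _ (hv _)]; simp only [prefixInf]; abel
    rw [e]
    refine (norm_add_le _ _).trans ?_
    have h1 := (norm_condOp_sub_le (hB hp).1 (condOp (v (k + 1)) P g) g).trans (h (k + 1))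
    have e2 : ε / 2 ^ k = 2 * (ε / 2 ^ (k + 1)) := by rw [pow_succ]; field_simp
    linarith

theorem strongClosure_subset_closure [TopologicalSpace.SeparableSpace (Lp ℝ 2 P)]
    (hB : B ⊆ sigmaFields P) (hc : IsCommuting P B) (hinf : ∀ x ∈ B, ∀ y ∈ B, x ⊓ y ∈ B) :
    strongClosure P B ⊆ closure B := by
  rintro x ⟨hx, u, hu, hux⟩
  have := separableSpace_L1 (P := P)
  let F := TopologicalSpace.denseSeq (Lp ℝ 1 P)
  have hxx : ∀ f : Lp ℝ 1 P, condOp x P (condOp x P f) = condOp x P f := fun f =>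
    condOp_of_mem hx.1 (condOp_mem hx.1 f)
  have hε : ∀ n : ℕ, (0 : ℝ) < 1 / 2 ^ n := fun n => by positivity
  choose κ hκ hvx using fun n : ℕ =>
    hux.exists_forall_norm_lt (fun i => condOp x P (F i)) n (hε n)
  simp only [hxx] at hvx
  let v : ℕ → MeasurableSpace Ω := fun n => u (κ n)
  have hv : ∀ n, v n ∈ B := fun n => hu _
  have hlim : StrongTendsto P v x := fun f => (hux f).comp (tendsto_atTop_mono hκ tendsto_id)
  have hy : ∀ n, ⨅ k, v (n + k) ∈ sigmaFields P := fun n =>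
    iInf_mem_sigmaFields fun k => hB (hv _)
  have hs : ⨆ n, ⨅ k, v (n + k) ∈ sigmaFields P := iSup_mem_sigmaFields hy
  have hcl := isClosed_measL1 (P := P) hs.1
  refine ⟨v, hv, le_antisymm ?_ (iSup_le fun n => ?_)⟩
  -- The errors `2⁻ⁿ` are summable, so the tail infimum from `n` on fixes `E_x (F i)` up to `2 ·
  -- 2⁻ⁿ` once `n ≥ i`.
  · refine le_of_forall_measL1_le hx.1 hs ?_
    have hF : ∀ i, condOp x P (F i) ∈ measL1 (⨆ n, ⨅ k, v (n + k)) P := by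
      intro i
      have hb : ∀ n ≥ i, ‖condOp (⨅ k, v (n + k)) P (condOp x P (F i)) - condOp x P (F i)‖
          ≤ 2 * (1 / 2 ^ n) := by
        intro n hn
        have hp := fun k => prefixInf_mem hinf (fun k => hv (n + k)) k
        have h1 := strongTendsto_iInf (P := P) (fun k => hB (hp k)) (prefixInf_antitone _)
        rw [iInf_prefixInf] at h1
        refine le_of_tendsto ((h1 (condOp x P (F i))).sub_const _).norm
          (Eventually.of_forall fun k => ?_)
        have h2 := norm_prefixInf_sub_le hB hc hinf (fun k => hv (n + k))
          (g := condOp x P (F i)) (ε := 1 / 2 ^ n) (fun k => ?_) k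
        · refine h2.trans (sub_le_self _ (by positivity))
        · refine (hvx (n + k) i (by omega)).le.trans (le_of_eq ?_)
          rw [pow_add]; field_simp
      refine hcl.mem_of_tendsto (b := atTop)
        (f := fun n => condOp (⨅ k, v (n + k)) P (condOp x P (F i))) ?_
        (Eventually.of_forall fun n =>
          measL1_mono (le_iSup (fun n => ⨅ k, v (n + k)) n) (condOp_mem (hy n).1 _))
      rw [tendsto_iff_norm_sub_tendsto_zero]
      refine squeeze_zero' (Eventually.of_forall fun n => norm_nonneg _)
        ((eventually_ge_atTop i).mono hb) ?_
      have := (tendsto_pow_atTop_nhds_zero_of_lt_one (r := (1 / 2 : ℝ)) (by norm_num)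
        (by norm_num)).const_mul 2
      simpa using this
    intro f hf
    rw [← condOp_of_mem hx.1 hf]
    have hpre : IsClosed (condOp x P ⁻¹' (measL1 (⨆ n, ⨅ k, v (n + k)) P : Set (Lp ℝ 1 P))) :=
      hcl.preimage (condOp x P).continuous
    refine hpre.closure_subset_iff.2 ?_ (TopologicalSpace.denseRange_denseSeq _ f)
    rintro _ ⟨i, rfl⟩
    exact hF i
  -- A function measurable for a tail infimum is fixed by all later operators, hence by their limit
  -- `E_x`.
  · refine le_of_forall_measL1_le (hy n).1 hx fun f hf => ?_
    have h1 : ∀ m ≥ n, condOp (v m) P f = f := fun m hm => by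
      refine condOp_of_mem (hB (hv m)).1 (measL1_mono ?_ hf)
      obtain ⟨k, rfl⟩ := Nat.exists_eq_add_of_le hm
      exact iInf_le _ k
    have h2 : Tendsto (fun m => condOp (v m) P f) atTop (𝓝 f) :=
      tendsto_const_nhds.congr' ((eventually_ge_atTop n).mono fun m hm => (h1 m hm).symm)
    rw [← tendsto_nhds_unique (hlim f) h2]
    exact condOp_mem hx.1 f

theorem closure_eq_strongClosure [TopologicalSpace.SeparableSpace (Lp ℝ 2 P)]
    (hB : B ⊆ sigmaFields P) (hc : IsCommuting P B) (hinf : ∀ x ∈ B, ∀ y ∈ B, x ⊓ y ∈ B) :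
    closure B = strongClosure P B :=
  (closure_subset_strongClosure hB hinf).antisymm (strongClosure_subset_closure hB hc hinf)

end Closure

/-! ### Conditioning and joins under independence. -/

section Indep

variable {Ω : Type*} {a b v w x y z z' : MeasurableSpace Ω} {mΩ : MeasurableSpace Ω}
  {P : Measure Ω} [IsProbabilityMeasure P]

omit [IsProbabilityMeasure P] in
theorem trivialField_mem_sigmaFields : trivialField P ∈ sigmaFields P :=
  ⟨fun _ h => h.1, fun _ hs h0 => ⟨hs, Or.inl h0⟩⟩

omit [IsProbabilityMeasure P] in
theorem mem_measL1_trivialField_of_ae_eq_const {f : Lp ℝ 1 P} {c : ℝ}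
    (h : f =ᵐ[P] fun _ => c) : f ∈ measL1 (trivialField P) P :=
  mem_measL1.2 ⟨_, stronglyMeasurable_const, h⟩

theorem condOp_trivialField (f : Lp ℝ 1 P) :
    condOp (trivialField P) P f =ᵐ[P] fun _ => ∫ ω, f ω ∂P := by
  refine (condOp_ae_eq trivialField_mem_sigmaFields.1 f).trans (EventuallyEq.symm ?_)
  refine ae_eq_condExp_of_forall_setIntegral_eq trivialField_mem_sigmaFields.1
    (L1.integrable_coeFn f) (fun s _ _ => (integrable_const _).integrableOn) ?_
    stronglyMeasurable_const.aestronglyMeasurable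
  rintro s ⟨-, h | h⟩ -
  · rw [Measure.restrict_eq_zero.2 h]; simp
  · rw [setIntegral_const]
    have hs : s =ᵐ[P] Set.univ := eventuallyEq_univ.2 h
    rw [setIntegral_congr_set hs, setIntegral_univ, measureReal_congr hs]
    simp

theorem condOp_ind_of_indep (hx : x ≤ mΩ) (hy : y ≤ mΩ) (h : Indep x y P) {A : Set Ω}
    (hA : MeasurableSet[x] A) : condOp y P (ind P (hx A hA)) ∈ measL1 (trivialField P) P := by
  refine mem_measL1_trivialField_of_ae_eq_const (c := P[A.indicator fun _ => (1 : ℝ)]) ?_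
  refine (condOp_ae_eq hy _).trans ((condExp_congr_ae (ind_ae_eq _)).trans ?_)
  exact condExp_indep_eq hx hy (stronglyMeasurable_const.indicator hA) h

/-- For `A` in `a` and `D` in `b`, `E_w (1_A 1_D) = 1_A P(D)`. -/
theorem condOp_mem_of_indep (ha : a ∈ sigmaFields P) (hw : w ≤ mΩ) (haw : a ≤ w) (hb : b ≤ mΩ)
    (h : Indep b w P) {f : Lp ℝ 1 P} (hf : f ∈ measL1 (a ⊔ b) P) :
    condOp w P f ∈ measL1 a P := by
  refine mem_of_forall_inter ha.1 hb ((measL1 a P).comap (condOp w P).toLinearMap)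
    ((isClosed_measL1 ha.1).preimage (condOp w P).continuous) (fun A D hA hD => ?_) hf
  have h1 := (isProd_ind (P := P) (ha.1 A hA) (hb D hD)).condOp hw (ind_mem hw (haw A hA))
  exact h1.mem (ind_mem ha.1 hA)
    (measL1_mono (trivialField_le ha) (condOp_ind_of_indep hb hw h hD))

/-- If `b` is independent of `w ⊇ a`, then conditioning on `a ⊔ b` and then on `w` is conditioning
on `a`. -/
theorem condOp_condOp_sup_of_indep (ha : a ∈ sigmaFields P) (hw : w ≤ mΩ) (haw : a ≤ w)
    (hb : b ≤ mΩ) (h : Indep b w P) (f : Lp ℝ 1 P) :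
    condOp w P (condOp (a ⊔ b) P f) = condOp a P f := by
  have hab : a ⊔ b ≤ mΩ := sup_le ha.1 hb
  rw [← condOp_of_mem ha.1 (condOp_mem_of_indep ha hw haw hb h (condOp_mem hab f)),
    condOp_condOp_of_le haw hw, condOp_condOp_of_le le_sup_left hab]

theorem sup_inf_of_indep (ha : a ∈ sigmaFields P) (hw : w ∈ sigmaFields P) (haw : a ≤ w)
    (hb : b ≤ mΩ) (h : Indep b w P) : (a ⊔ b) ⊓ w = a := by
  refine le_antisymm ?_ (le_inf le_sup_left haw)
  refine le_of_forall_measL1_le (inf_le_right.trans hw.1) ha fun f hf => ?_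
  rw [← condOp_of_mem hw.1 (measL1_mono inf_le_right hf)]
  exact condOp_mem_of_indep ha hw.1 haw hb h (measL1_mono inf_le_left hf)

/-- The adjoint of `condOp_condOp_sup_of_indep`, obtained by testing against indicators `1_S` with
`S` in `a ⊔ b`. -/
theorem condOp_sup_ind_of_indep (ha : a ∈ sigmaFields P) (hw : w ≤ mΩ) (haw : a ≤ w)
    (hb : b ≤ mΩ) (h : Indep b w P) {D : Set Ω} (hD : MeasurableSet[w] D) :
    condOp (a ⊔ b) P (ind P (hw D hD)) = condOp a P (ind P (hw D hD)) := by
  have hab : a ⊔ b ≤ mΩ := sup_le ha.1 hb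
  refine condOp_unique hab (measL1_mono le_sup_left (condOp_mem ha.1 _)) fun S hS => ?_
  have key : ∀ g : Lp ℝ 1 P, ∫ ω in S, g ω ∂P = ∫ ω, ind P (hab S hS) ω * g ω ∂P := fun g => by
    rw [← integral_indicator (hab S hS)]
    refine integral_congr_ae ?_
    filter_upwards [ind_ae_eq (P := P) (hab S hS)] with ω hω
    rw [hω]
    by_cases hs : ω ∈ S <;> simp [hs]
  have bS : BddOne (ind P (hab S hS)) := bddOne_ind _
  have bD : BddOne (ind P (hw D hD)) := bddOne_ind _
  have h1 : condOp w P (ind P (hab S hS)) = condOp a P (ind P (hab S hS)) := by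
    rw [← condOp_condOp_sup_of_indep ha hw haw hb h, condOp_of_mem hab (ind_mem hab hS)]
  have h2 := integral_condOp_mul hw (g := ind P (hab S hS)) bD (ind_mem hw hD)
  have h3 := integral_condOp_mul ha.1 (g := ind P (hw D hD)) (bS.condOp ha.1) (condOp_mem ha.1 _)
  have h4 := integral_condOp_mul ha.1 (g := ind P (hab S hS)) (bD.condOp ha.1) (condOp_mem ha.1 _)
  rw [key, key]
  have hcomm : ∀ p q : Lp ℝ 1 P, ∫ ω, p ω * q ω ∂P = ∫ ω, q ω * p ω ∂P := fun p q => by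
    simp only [mul_comm]
  rw [hcomm, ← h4, hcomm, h3, ← h1, hcomm, h2]
  exact hcomm _ _

theorem indep_of_condOp (hx : x ≤ mΩ) (hy : y ≤ mΩ)
    (h : ∀ f : Lp ℝ 1 P, condOp x P (condOp y P f) = condOp (trivialField P) P f) :
    Indep x y P := by
  rw [Indep_iff]
  intro A D hA hD
  have hp := (isProd_ind (P := P) (hx A hA) (hy D hD)).condOp hx (ind_mem hx hA)
  have h1 : condOp x P (ind P (hy D hD)) =ᵐ[P] fun _ => P.real D := by
    have := condOp_trivialField (ind P (hy D hD))
    rwa [← h, condOp_of_mem hy (ind_mem hy hD), integral_ind] at this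
  have h2 : P.real (A ∩ D) = P.real A * P.real D := by
    have e := setIntegral_condOp hx (ind P ((hx A hA).inter (hy D hD)))
      (A := Set.univ) (@MeasurableSet.univ _ x)
    rw [setIntegral_univ, setIntegral_univ, integral_ind] at e
    rw [← e, ← integral_ind (hx A hA), ← integral_mul_const]
    refine integral_congr_ae ?_
    filter_upwards [hp, h1] with ω h3 h4
    rw [h3, Pi.mul_apply, h4]
  simp only [Measure.real, ← ENNReal.toReal_mul] at h2
  exact (ENNReal.toReal_eq_toReal_iff' (measure_ne_top _ _)
    (ENNReal.mul_ne_top (measure_ne_top _ _) (measure_ne_top _ _))).1 h2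

/-- Joining with a `σ`-field `z` that has an independent complement `z'` is continuous
on the `σ`-fields below `z'`. -/
theorem StrongTendsto.sup_of_indep (hz : z ≤ mΩ) (hz' : z' ≤ mΩ) (hzz : z ⊔ z' = mΩ)
    (h : Indep z z' P) {u : ℕ → MeasurableSpace Ω} (hu : ∀ n, u n ∈ sigmaFields P)
    (huz : ∀ n, u n ≤ z') (hv : v ∈ sigmaFields P) (hvz : v ≤ z') (huv : StrongTendsto P u v) :
    StrongTendsto P (fun n => z ⊔ u n) (z ⊔ v) := by
  -- On rectangles `E_{z ⊔ a} (1_A 1_D) = 1_A · E_a 1_D`, where only the last factor depends on `a`.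
  have key : ∀ a, a ∈ sigmaFields P → a ≤ z' → ∀ A D, ∀ hA : MeasurableSet[z] A,
      ∀ hD : MeasurableSet[z'] D, IsProd (ind P (hz A hA)) (condOp a P (ind P (hz' D hD)))
        (condOp (z ⊔ a) P (ind P ((hz A hA).inter (hz' D hD)))) := by
    intro a ha haz A D hA hD
    rw [← condOp_sup_ind_of_indep ha hz' haz hz h hD, sup_comm a z]
    exact (isProd_ind (hz A hA) (hz' D hD)).condOp (sup_le hz ha.1)
      (measL1_mono le_sup_left (ind_mem hz hA))
  refine strongTendsto_of_forall_inter (fun n => sup_le hz (hu n).1) (sup_le hz hv.1) hz hz' hzz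
    fun A D hA hD => ?_
  exact tendsto_isProd (fun n => key _ (hu n) (huz n) A D hA hD) (key _ hv hvz A D hA hD)
    (fun _ => bddOne_ind _) ((bddOne_ind _).condOp hv.1) tendsto_const_nhds (huv _)

end Indep

/-! ### Complemented elements of the closure. -/

section Algebra

variable {Ω : Type*} {u v x y z z' : MeasurableSpace Ω} {mΩ : MeasurableSpace Ω}
  {P : Measure Ω} [IsProbabilityMeasure P] {B : Set (MeasurableSpace Ω)}

omit [IsProbabilityMeasure P] in
theorem IsComplement.symm (h : IsComplement P x y) : IsComplement P y x :=
  ⟨inf_comm x y ▸ h.1, sup_comm x y ▸ h.2⟩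

theorem IsNoiseTypeBooleanAlgebra.isCommuting (hB : IsNoiseTypeBooleanAlgebra P B) :
    IsCommuting P B := by
  intro y hy x hx f
  obtain ⟨y', hy', hc⟩ := hB.exists_complement y hy
  have hS := hB.subset_sigmaFields
  have hsplit : x = (y ⊓ x) ⊔ (y' ⊓ x) := by
    rw [inf_comm y, inf_comm y', ← hB.distrib x hx y hy y' hy', hc.2, inf_eq_left.2 (hS hx).1]
  have hi : Indep (y' ⊓ x) y P :=
    indep_of_indep_of_le_left (hB.indep_complement y hy y' hy' hc).symm inf_le_left
  have := condOp_condOp_sup_of_indep (hS (hB.inf_mem y hy x hx)) (hS hy).1 inf_le_left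
    (inf_le_left.trans (hS hy').1) hi f
  rwa [← hsplit] at this

/-- Two elements whose intersection lies in `u` are conditionally independent given `u`. -/
theorem IsNoiseTypeBooleanAlgebra.isProd_condOp (hB : IsNoiseTypeBooleanAlgebra P B)
    (hu : u ∈ B) (hx : x ∈ B) (hy : y ∈ B) (h : x ⊓ y ≤ u) {f g k : Lp ℝ 1 P}
    (hf : f ∈ measL1 x P) (hg : g ∈ measL1 y P) (hp : IsProd f g k) :
    IsProd (condOp u P f) (condOp u P g) (condOp u P k) := by
  have hS := hB.subset_sigmaFields
  have huy := hB.sup_mem u hu y hy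
  -- Both sides equal `E_{x ⊓ u} f`, because `x ⊓ (u ⊔ y) = (x ⊓ u) ⊔ (x ⊓ y) = x ⊓ u`.
  have e : condOp (u ⊔ y) P f = condOp u P f := by
    have h1 := hB.isCommuting _ huy x hx f
    have h2 := hB.isCommuting u hu x hx f
    rw [condOp_of_mem (hS hx).1 hf] at h1 h2
    rw [h1, h2, inf_comm, hB.distrib x hx u hu y hy, inf_comm u x,
      sup_eq_left.2 (le_inf inf_le_left h)]
  have h1 := (hp.comm.condOp (hS huy).1 (measL1_mono le_sup_right hg)).comm
  rw [e] at h1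
  have h2 := h1.condOp (hS hu).1 (condOp_mem (hS hu).1 f)
  rwa [condOp_condOp_of_le le_sup_left (hS huy).1] at h2

omit [IsProbabilityMeasure P] in
theorem IsNoiseTypeBooleanAlgebra.sup_inf_complement (hB : IsNoiseTypeBooleanAlgebra P B)
    (hu : u ∈ B) (hz : z ∈ B) (hz' : z' ∈ B) (hc : IsComplement P z z') :
    u = (u ⊓ z) ⊔ (u ⊓ z') := by
  rw [← hB.distrib u hu z hz z' hz', hc.2, inf_eq_left.2 (hB.subset_sigmaFields hu).1]

/-- Only `w n ⊓ u'` contributes to the join; it still tends to `0_Λ`, and joining with `u` is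
continuous below `u'`. -/
theorem IsNoiseTypeBooleanAlgebra.strongTendsto_sup_of_tendsto_trivial
    (hB : IsNoiseTypeBooleanAlgebra P B) (hu : u ∈ B) {w : ℕ → MeasurableSpace Ω}
    (hw : ∀ n, w n ∈ B) (h : StrongTendsto P w (trivialField P)) :
    StrongTendsto P (fun n => u ⊔ w n) u := by
  have hS := hB.subset_sigmaFields
  obtain ⟨u', hu', hc⟩ := hB.exists_complement u hu
  have h1 : ∀ n, u ⊔ w n = u ⊔ (w n ⊓ u') := fun n => by
    conv_lhs => rw [hB.sup_inf_complement (hw n) hu hu' hc]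
    rw [← sup_assoc, sup_eq_left.2 (inf_le_right : w n ⊓ u ≤ u)]
  have h2 := (StrongTendsto.inf hS hB.isCommuting hw (fun _ => hu') trivialField_mem_sigmaFields
    (hS hu') h (fun _ => tendsto_const_nhds)).2
  rw [inf_eq_left.2 (trivialField_le (hS hu'))] at h2
  have h3 := StrongTendsto.sup_of_indep (hS hu).1 (hS hu').1 hc.2
    (hB.indep_complement u hu u' hu' hc) (fun n => hS (hB.inf_mem _ (hw n) u' hu'))
    (fun n => inf_le_right) trivialField_mem_sigmaFields (trivialField_le (hS hu')) h2
  rw [sup_eq_left.2 (trivialField_le (hS hu))] at h3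
  simpa only [h1] using h3

/-- Complementary elements of the closure are conditionally independent given any element of the
algebra. -/
theorem IsNoiseTypeBooleanAlgebra.isProd_condOp_ind (hB : IsNoiseTypeBooleanAlgebra P B)
    (hu : u ∈ B) (hx : x ∈ strongClosure P B) (hy : y ∈ strongClosure P B)
    (hc : IsComplement P x y) {A D : Set Ω} (hA : MeasurableSet[x] A) (hD : MeasurableSet[y] D) :
    IsProd (condOp u P (ind P (hx.1.1 A hA))) (condOp u P (ind P (hy.1.1 D hD)))
      (condOp u P (ind P ((hx.1.1 A hA).inter (hy.1.1 D hD)))) := by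
  have hS := hB.subset_sigmaFields
  obtain ⟨hxS, a, ha, hax⟩ := hx
  obtain ⟨hyS, b, hb, hby⟩ := hy
  have hw : ∀ n, a n ⊓ b n ∈ B := fun n => hB.inf_mem _ (ha n) _ (hb n)
  have hU : ∀ n, u ⊔ (a n ⊓ b n) ∈ B := fun n => hB.sup_mem u hu _ (hw n)
  have hlim : StrongTendsto P (fun n => u ⊔ (a n ⊓ b n)) u := by
    have h1 := (StrongTendsto.inf hS hB.isCommuting ha hb hxS hyS hax hby).2
    rw [hc.1] at h1
    exact hB.strongTendsto_sup_of_tendsto_trivial hu hw h1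
  set f := ind P (hxS.1 A hA)
  set g := ind P (hyS.1 D hD)
  have bf : BddOne f := bddOne_ind _
  have bg : BddOne g := bddOne_ind _
  have hf : Tendsto (fun n => condOp (a n) P f) atTop (𝓝 f) := by
    have := hax f
    rwa [condOp_of_mem hxS.1 (ind_mem hxS.1 hA)] at this
  have hg : Tendsto (fun n => condOp (b n) P g) atTop (𝓝 g) := by
    have := hby g
    rwa [condOp_of_mem hyS.1 (ind_mem hyS.1 hD)] at this
  have bfn : ∀ n, BddOne (condOp (a n) P f) := fun n => bf.condOp (hS (ha n)).1
  -- `k n` approximates `1_A 1_D` by a product of an `a n`-measurable and a `b n`-measurable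
  -- function, to which conditional independence in `B` applies.
  choose k hk using fun n => exists_isProd (bfn n) (condOp (b n) P g)
  have hkl := tendsto_isProd hk (isProd_ind (hxS.1 A hA) (hyS.1 D hD)) bfn bg hf hg
  have hp : ∀ n, IsProd (condOp (u ⊔ (a n ⊓ b n)) P (condOp (a n) P f))
      (condOp (u ⊔ (a n ⊓ b n)) P (condOp (b n) P g)) (condOp (u ⊔ (a n ⊓ b n)) P (k n)) :=
    fun n => hB.isProd_condOp (hU n) (ha n) (hb n) le_sup_right (condOp_mem (hS (ha n)).1 _)
      (condOp_mem (hS (hb n)).1 _) (hk n)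
  have hUle := fun n => (hS (hU n)).1
  have bfu : BddOne (condOp u P f) := bf.condOp (hS hu).1
  obtain ⟨q, hq⟩ := exists_isProd bfu (condOp u P g)
  have h1 := tendsto_isProd hp hq (fun n => (bfn n).condOp (hUle n)) (bg.condOp (hS hu).1)
    (hlim.apply hUle hf) (hlim.apply hUle hg)
  rwa [tendsto_nhds_unique h1 (hlim.apply hUle hkl)] at hq

/-- An element of the closure is generated by its intersections with complementary elements of the
closure. -/
theorem IsNoiseTypeBooleanAlgebra.closure_sup_inf_complement
    (hB : IsNoiseTypeBooleanAlgebra P B) (hu : u ∈ strongClosure P B)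
    (hx : x ∈ strongClosure P B) (hy : y ∈ strongClosure P B) (hc : IsComplement P x y) :
    u = (u ⊓ x) ⊔ (u ⊓ y) := by
  have hS := hB.subset_sigmaFields
  have hcomm := strongClosure_isCommuting hS hB.isCommuting
  refine le_antisymm ?_ (sup_le inf_le_left inf_le_left)
  have hux := inf_mem_sigmaFields hu.1 hx.1
  have huy := inf_mem_sigmaFields hu.1 hy.1
  have hk := sup_mem_sigmaFields hux huy
  refine le_of_forall_measL1_le hu.1.1 hk fun f hf => ?_
  rw [← condOp_of_mem hu.1.1 hf]
  refine mem_of_forall_inter hx.1.1 hy.1.1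
    ((measL1 (u ⊓ x ⊔ u ⊓ y) P).comap (condOp u P).toLinearMap)
    ((isClosed_measL1 hk.1).preimage (condOp u P).continuous) (fun A D hA hD => ?_)
    (f := f) (by rw [hc.2, mem_measL1]; exact Lp.aestronglyMeasurable f)
  obtain ⟨-, a, ha, hau⟩ := id hu
  have hale := fun n => (hS (ha n)).1
  have bA : BddOne (ind P (hx.1.1 A hA)) := bddOne_ind _
  have bD : BddOne (ind P (hy.1.1 D hD)) := bddOne_ind _
  obtain ⟨q, hq⟩ := exists_isProd (bA.condOp hu.1.1) (condOp u P (ind P (hy.1.1 D hD)))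
  -- The product formula, known given `a n` in `B`, passes to the limit `u`.
  have h1 := tendsto_isProd (fun n => hB.isProd_condOp_ind (ha n) hx hy hc hA hD) hq
    (fun n => bA.condOp (hale n)) (bD.condOp hu.1.1) (hau _) (hau _)
  rw [Submodule.mem_comap]
  change condOp u P _ ∈ measL1 (u ⊓ x ⊔ u ⊓ y) P
  rw [← tendsto_nhds_unique h1 (hau _)]
  have hA' := hcomm u hu x hx (ind P (hx.1.1 A hA))
  have hD' := hcomm u hu y hy (ind P (hy.1.1 D hD))
  rw [condOp_of_mem hx.1.1 (ind_mem hx.1.1 hA)] at hA'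
  rw [condOp_of_mem hy.1.1 (ind_mem hy.1.1 hD)] at hD'
  rw [hA', hD'] at hq
  exact hq.mem (measL1_mono le_sup_left (condOp_mem hux.1 _))
    (measL1_mono le_sup_right (condOp_mem huy.1 _))

theorem IsNoiseTypeBooleanAlgebra.closure_indep_complement
    (hB : IsNoiseTypeBooleanAlgebra P B) (hx : x ∈ strongClosure P B)
    (hy : y ∈ strongClosure P B) (hc : IsComplement P x y) : Indep x y P := by
  refine indep_of_condOp hx.1.1 hy.1.1 fun f => ?_
  rw [strongClosure_isCommuting hB.subset_sigmaFields hB.isCommuting x hx y hy f, hc.1]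

theorem IsNoiseTypeBooleanAlgebra.closure_sup_eq
    (hB : IsNoiseTypeBooleanAlgebra P B) (hu : u ∈ strongClosure P B)
    (hz : z ∈ strongClosure P B) (hz' : z' ∈ strongClosure P B) (hc : IsComplement P z z') :
    z ⊔ u = z ⊔ (u ⊓ z') := by
  conv_lhs => rw [hB.closure_sup_inf_complement hu hz hz' hc]
  rw [← sup_assoc, sup_eq_left.2 (inf_le_right : u ⊓ z ≤ z)]

theorem IsNoiseTypeBooleanAlgebra.strongTendsto_sup
    (hB : IsNoiseTypeBooleanAlgebra P B) (hz : z ∈ strongClosure P B)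
    (hz' : z' ∈ strongClosure P B) (hc : IsComplement P z z') {a : ℕ → MeasurableSpace Ω}
    (ha : ∀ n, a n ∈ strongClosure P B) (hu : u ∈ strongClosure P B) (h : StrongTendsto P a u) :
    StrongTendsto P (fun n => z ⊔ a n) (z ⊔ u) := by
  have hcomm := strongClosure_isCommuting hB.subset_sigmaFields hB.isCommuting
  have h2 := (StrongTendsto.inf strongClosure_subset_sigmaFields hcomm ha (fun _ => hz') hu.1
    hz'.1 h (fun _ => tendsto_const_nhds)).2
  have h3 := StrongTendsto.sup_of_indep hz.1.1 hz'.1.1 hc.2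
    (hB.closure_indep_complement hz hz' hc) (fun n => inf_mem_sigmaFields (ha n).1 hz'.1)
    (fun n => inf_le_right) (inf_mem_sigmaFields hu.1 hz'.1) inf_le_right h2
  simpa only [fun n => hB.closure_sup_eq (ha n) hz hz' hc, hB.closure_sup_eq hu hz hz' hc] using h3

variable [TopologicalSpace.SeparableSpace (Lp ℝ 2 P)]

/-- Continuity of the join is used twice: first with an element of `B` fixed and `u` varying, then
with `z` fixed and `u` approximated from `B`. Idempotence of the closure concludes. -/
theorem IsNoiseTypeBooleanAlgebra.closure_sup_mem
    (hB : IsNoiseTypeBooleanAlgebra P B) (hz : z ∈ strongClosure P B)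
    (hz' : z' ∈ strongClosure P B) (hc : IsComplement P z z') (hu : u ∈ strongClosure P B) :
    z ⊔ u ∈ strongClosure P B := by
  have hS := hB.subset_sigmaFields
  have hsub := subset_strongClosure hS
  have hstep : ∀ b ∈ B, ∀ u ∈ strongClosure P B, b ⊔ u ∈ strongClosure P B := by
    intro b hb u hu
    obtain ⟨b', hb', hbc⟩ := hB.exists_complement b hb
    obtain ⟨-, a, ha, hau⟩ := id hu
    exact ⟨sup_mem_sigmaFields (hS hb) hu.1, fun n => b ⊔ a n, fun n => hB.sup_mem b hb _ (ha n),
      hB.strongTendsto_sup (hsub hb) (hsub hb') hbc (fun n => hsub (ha n)) hu hau⟩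
  obtain ⟨-, a, ha, hau⟩ := id hu
  refine strongClosure_idem hS ⟨sup_mem_sigmaFields hz.1 hu.1, fun n => z ⊔ a n, fun n => ?_,
    hB.strongTendsto_sup hz hz' hc (fun n => hsub (ha n)) hu hau⟩
  simpa only [sup_comm z] using hstep _ (ha n) z hz

theorem IsNoiseTypeBooleanAlgebra.closure_eq (hB : IsNoiseTypeBooleanAlgebra P B) :
    closure B = strongClosure P B :=
  closure_eq_strongClosure hB.subset_sigmaFields hB.isCommuting hB.inf_mem

omit [TopologicalSpace.SeparableSpace (Lp ℝ 2 P)] in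
theorem IsNoiseTypeBooleanAlgebra.closure_inf_mem (hB : IsNoiseTypeBooleanAlgebra P B) :
    ∀ x ∈ strongClosure P B, ∀ y ∈ strongClosure P B, x ⊓ y ∈ strongClosure P B :=
  strongClosure_inf_mem hB.subset_sigmaFields hB.isCommuting hB.inf_mem

omit [TopologicalSpace.SeparableSpace (Lp ℝ 2 P)] in
/-- The intersection distributes over the join with an element complemented in the closure. -/
theorem IsNoiseTypeBooleanAlgebra.closure_distrib
    (hB : IsNoiseTypeBooleanAlgebra P B) (hu : u ∈ strongClosure P B)
    (hy : y ∈ strongClosure P B) (hz' : z' ∈ strongClosure P B) (hc : IsComplement P y z')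
    (hv : v ∈ strongClosure P B) (hyv : y ⊔ v ∈ strongClosure P B) :
    u ⊓ (y ⊔ v) = (u ⊓ y) ⊔ (u ⊓ v) := by
  refine le_antisymm ?_ (sup_le (inf_le_inf_left _ le_sup_left) (inf_le_inf_left _ le_sup_right))
  have h1 := hB.closure_sup_inf_complement (hB.closure_inf_mem _ hu _ hyv) hy hz' hc
  rw [h1]
  refine sup_le_sup (inf_le_inf_right _ inf_le_left) (le_inf (inf_le_left.trans inf_le_left) ?_)
  -- Independence supplies the modular identity `(y ⊔ v) ⊓ z' = v ⊓ z'`.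
  have h2 := sup_inf_of_indep (inf_mem_sigmaFields hv.1 hz'.1) hz'.1 inf_le_right hy.1.1
    (hB.closure_indep_complement hy hz' hc)
  rw [sup_comm, ← hB.closure_sup_eq hv hy hz' hc] at h2
  rw [inf_assoc, h2]
  exact inf_le_right.trans inf_le_left

theorem IsNoiseTypeBooleanAlgebra.isComplement_inf
    (hB : IsNoiseTypeBooleanAlgebra P B) {x' y' : MeasurableSpace Ω}
    (hx : x ∈ strongClosure P B) (hx' : x' ∈ strongClosure P B) (hcx : IsComplement P x x')
    (hy : y ∈ strongClosure P B) (hy' : y' ∈ strongClosure P B) (hcy : IsComplement P y y') :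
    IsComplement P (x ⊓ y) (x' ⊔ y') := by
  have h1 := hB.closure_sup_mem hx' hx hcx.symm hy'
  constructor
  · rw [hB.closure_distrib (hB.closure_inf_mem x hx y hy) hx' hx hcx.symm hy' h1]
    refine le_antisymm (sup_le ?_ ?_) (le_sup_of_le_left
      (trivialField_le (inf_mem_sigmaFields (inf_mem_sigmaFields hx.1 hy.1) hx'.1)))
    · exact hcx.1 ▸ inf_le_inf_right _ inf_le_left
    · exact hcy.1 ▸ inf_le_inf_right _ inf_le_right
  · refine le_antisymm (sup_le (inf_le_left.trans hx.1.1) h1.1.1) ?_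
    -- Split `x` along `y` and `y'`: the second piece lies below `y'`.
    have h2 : x ≤ x ⊓ y ⊔ (x' ⊔ y') := by
      conv_lhs => rw [hB.closure_sup_inf_complement hx hy hy' hcy]
      exact sup_le_sup le_rfl (inf_le_right.trans le_sup_right)
    calc mΩ = x ⊔ x' := hcx.2.symm
      _ ≤ _ := sup_le h2 (le_sup_left.trans le_sup_right)

theorem IsNoiseTypeBooleanAlgebra.mem_completion (hB : IsNoiseTypeBooleanAlgebra P B) :
    x ∈ completion P B ↔
      x ∈ strongClosure P B ∧ ∃ y ∈ strongClosure P B, IsComplement P x y := by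
  rw [← hB.closure_eq]; rfl

theorem IsNoiseTypeBooleanAlgebra.subset_completion (hB : IsNoiseTypeBooleanAlgebra P B) :
    B ⊆ completion P B := fun x hx => by
  obtain ⟨y, hy, hc⟩ := hB.exists_complement x hx
  have hsub := subset_strongClosure hB.subset_sigmaFields
  exact hB.mem_completion.2 ⟨hsub hx, y, hsub hy, hc⟩

theorem IsNoiseTypeBooleanAlgebra.completion (hB : IsNoiseTypeBooleanAlgebra P B) :
    IsNoiseTypeBooleanAlgebra P (completion P B) where
  subset_sigmaFields x hx := (hB.mem_completion.1 hx).1.1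
  inf_mem x hx y hy := by
    obtain ⟨hx, x', hx', hcx⟩ := hB.mem_completion.1 hx
    obtain ⟨hy, y', hy', hcy⟩ := hB.mem_completion.1 hy
    exact hB.mem_completion.2 ⟨hB.closure_inf_mem x hx y hy, x' ⊔ y',
      hB.closure_sup_mem hx' hx hcx.symm hy', hB.isComplement_inf hx hx' hcx hy hy' hcy⟩
  sup_mem x hx y hy := by
    obtain ⟨hx, x', hx', hcx⟩ := hB.mem_completion.1 hx
    obtain ⟨hy, y', hy', hcy⟩ := hB.mem_completion.1 hy
    exact hB.mem_completion.2 ⟨hB.closure_sup_mem hx hx' hcx hy, x' ⊓ y',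
      hB.closure_inf_mem x' hx' y' hy',
      (hB.isComplement_inf hx' hx hcx.symm hy' hy hcy.symm).symm⟩
  distrib x hx y hy z hz := by
    obtain ⟨hy, y', hy', hcy⟩ := hB.mem_completion.1 hy
    have hz := (hB.mem_completion.1 hz).1
    exact hB.closure_distrib (hB.mem_completion.1 hx).1 hy hy' hcy hz
      (hB.closure_sup_mem hy hy' hcy hz)
  zero_mem := hB.subset_completion hB.zero_mem
  one_mem := hB.subset_completion hB.one_mem
  exists_complement x hx := by
    obtain ⟨hx, y, hy, hc⟩ := hB.mem_completion.1 hx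
    exact ⟨y, hB.mem_completion.2 ⟨hy, x, hx, hc.symm⟩, hc⟩
  indep_complement x hx y hy hc :=
    hB.closure_indep_complement (hB.mem_completion.1 hx).1 (hB.mem_completion.1 hy).1 hc

end Algebra

end NoiseType

theorem mainTheorem4 {Ω : Type*} {mΩ : MeasurableSpace Ω} (P : MeasureTheory.Measure Ω)
    [MeasureTheory.IsProbabilityMeasure P]
    [TopologicalSpace.SeparableSpace (MeasureTheory.Lp ℝ 2 P)]
    (B : Set (MeasurableSpace Ω)) (hB : NoiseType.IsNoiseTypeBooleanAlgebra P B) :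
    (NoiseType.IsNoiseTypeBooleanAlgebra P (NoiseType.completion P B) ∧
      B ⊆ NoiseType.completion P B ∧
      NoiseType.completion P B ⊆ NoiseType.closure B) ∧
    ∀ C₁ : Set (MeasurableSpace Ω), NoiseType.IsNoiseTypeBooleanAlgebra P C₁ →
      B ⊆ C₁ → C₁ ⊆ NoiseType.closure B → C₁ ⊆ NoiseType.completion P B := by
  refine ⟨⟨hB.completion, hB.subset_completion, fun x hx => hx.1⟩,
    fun C₁ hC _ hsub x hx => ?_⟩
  obtain ⟨y, hy, hc⟩ := hC.exists_complement x hx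
  exact ⟨hsub hx, y, hsub hy, hc⟩
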